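/- Let $\mathbb{T}=\mathbb{R}/\mathbb{Z}$, let $\|\cdot\|$ denote the distance to $0$ in $\mathbb{T}$, let $\lambda$ be Lebesgue measure on $\mathbb{T}$ (of total mass $1$), and let $\omega=(\omega_n)_{n\ge 1}$ be independent random points, each uniformly distributed on $\mathbb{T}$. For a real sequence $(r_n)_{n\ge 1}$ put \[ \mathcal U(\omega)=\{\,y\in\mathbb{T}:\ \text{for all sufficiently large } N \text{ there is } 1\le n\le N \text{ with } \|\omega_n-y\|<r_N\,\}. \] Monotonicity below is understood in the weak sense. (i) Let $(r_n)_{n\ge1}$ be a decreasing sequence of positive real numbers. Then either $\lambda(\mathcal U(\omega))=1$ almost surely, or $\lambda(\mathcal U(\omega))=0$ almost surely; which of the two holds depends only on $(r_n)_{n\ge1}$. (ii) Let $(r_n)_{n\ge1}$ be a decreasing sequence of positive real numbers such that $(n r_n)_{n\ge1}$ is monotone (increasing or decreasing). Then $\lambda(\mathcal U(\omega))=1$ almost surely if and only if \[ \sum_{n=1}^\infty r_n=\infty\qquad\text{and}\qquad \sum_{n=1}^\infty r_n e^{-2 n r_n}<\infty . \] In particular, if $c\in\mathbb{R}$ and $r_n=\dfrac{c\log\log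 n}{2n}$ for all sufficiently large $n$ (with arbitrary real values for the remaining $n$), then $\lambda(\mathcal U(\omega))=1$ almost surely if and only if $c>1$. -/

import Mathlib

open MeasureTheory ProbabilityTheory Filter

universe u

/-- The uniform covering set of a sequence `x` of points of the circle `ℝ / ℤ` with radii `r`:
the points `y` such that for all sufficiently large `N` there is `1 ≤ n ≤ N` with
`‖x n - y‖ < r N`, where `‖·‖` is the distance to `0` in `ℝ / ℤ`. -/
def uniformCoveringSet (r : ℕ+ → ℝ) (x : ℕ+ → UnitAddCircle) : Set UnitAddCircle :=
  {y | ∀ᶠ N in atTop, ∃ n ≤ N, ‖x n - y‖ < r N}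

/-- `ω 1, ω 2, …` are independent random points of the circle, each with the uniform law
(on `UnitAddCircle`, `volume` is Lebesgue measure, of total mass one). -/
structure IsIIDUniform {Ω : Type u} [MeasurableSpace Ω] (P : Measure Ω)
    (ω : ℕ+ → Ω → UnitAddCircle) : Prop where
  hasLaw : ∀ n, HasLaw (ω n) volume P
  indep : iIndepFun ω P

/-! By Fubini and translation invariance, the covering set has full (or zero) measure almost surely
exactly when the single point `0` is almost surely covered (or not covered). The point `0` is missed
iff, for infinitely many `N`, the first `N` points all avoid the ball of radius `r N`. If `r` tends
to `0`, finitely many points have no influence on this event, so Kolmogorov's law applies; if `r` is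
bounded below, `0` is almost surely covered.

For the criterion, let `G N` be the event `firstHit (r N) N`; its probability is comparable to `2 r
N exp (-2 N r N)`, up to a summable error. As `r` decreases, avoidance at time `N` can end only
through `G N`. If the series converges, Borel–Cantelli excludes late occurrences of `G N`, so one
late avoidance would persist forever; this has probability zero once `N r N → ∞`
(`ae_zero_mem_of_summable`).

If the series diverges and `N r N` increases, a second-moment argument gives the unions of late `G
N`, hence of late avoidances, probability bounded below (`not_ae_zero_mem_of_not_summable`). The key
is quasi-independence of `G M` and `G N`: the excess over a multiple of the product of the
probabilities is at most `P (G M)` times a geometric term whose sum over `N` is bounded.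

If `N r N` decreases it is bounded. Then avoidance at time `N` has probability bounded below for
large `N`, while the two series conditions contradict each other. -/

instance isProbabilityMeasure_volume_unitAddCircle :
    IsProbabilityMeasure (volume : Measure UnitAddCircle) :=
  ⟨UnitAddCircle.measure_univ⟩

/-- The law of a sequence of independent uniform points of the circle. -/
noncomputable def iidUniform : Measure (ℕ+ → UnitAddCircle) :=
  Measure.infinitePi fun _ => volume

instance : IsProbabilityMeasure iidUniform := by
  unfold iidUniform; infer_instance

/-! ### Measurability of the covering set -/

theorem measurableSet_mem_uniformCoveringSet (r : ℕ+ → ℝ) :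
    MeasurableSet {p : (ℕ+ → UnitAddCircle) × UnitAddCircle | p.2 ∈ uniformCoveringSet r p.1} := by
  have : {p : (ℕ+ → UnitAddCircle) × UnitAddCircle | p.2 ∈ uniformCoveringSet r p.1} =
      ⋃ K : ℕ+, ⋂ N : ℕ+, ⋂ _ : K ≤ N, ⋃ n : ℕ+, ⋃ _ : n ≤ N,
        {p : (ℕ+ → UnitAddCircle) × UnitAddCircle | ‖p.1 n - p.2‖ < r N} := by
    ext p
    simp [uniformCoveringSet, eventually_atTop]
  rw [this]
  refine .iUnion fun K => .iInter fun N => .iInter fun _ => .iUnion fun n => .iUnion fun _ => ?_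
  exact measurableSet_lt (by fun_prop) measurable_const

theorem measurableSet_zero_mem_uniformCoveringSet (r : ℕ+ → ℝ) :
    MeasurableSet {x : ℕ+ → UnitAddCircle | 0 ∈ uniformCoveringSet r x} :=
  (measurable_id.prodMk measurable_const :
    Measurable fun x : ℕ+ → UnitAddCircle => (x, (0 : UnitAddCircle)))
    (measurableSet_mem_uniformCoveringSet r)

theorem measurableSet_uniformCoveringSet (r : ℕ+ → ℝ) (x : ℕ+ → UnitAddCircle) :
    MeasurableSet (uniformCoveringSet r x) :=
  (measurable_const.prodMk measurable_id : Measurable fun y : UnitAddCircle => (x, y))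
    (measurableSet_mem_uniformCoveringSet r)

theorem measurable_volume_uniformCoveringSet (r : ℕ+ → ℝ) :
    Measurable fun x : ℕ+ → UnitAddCircle => volume (uniformCoveringSet r x) :=
  measurable_measure_prodMk_left (measurableSet_mem_uniformCoveringSet r)

/-! ### Reduction to the point `0` and to the product space -/

theorem iidUniform_map_sub (y : UnitAddCircle) :
    iidUniform.map (fun x n => x n - y) = iidUniform := by
  unfold iidUniform
  have h := Measure.infinitePi_map_pi (μ := fun _ : ℕ+ => (volume : Measure UnitAddCircle))
    (f := fun _ x => x - y) (fun _ => by fun_prop)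
  rw [h]
  congr 1
  funext _
  exact (measurePreserving_sub_right volume y).map_eq

theorem mem_uniformCoveringSet_iff_sub (r : ℕ+ → ℝ) (x : ℕ+ → UnitAddCircle) (y : UnitAddCircle) :
    y ∈ uniformCoveringSet r x ↔ 0 ∈ uniformCoveringSet r (fun n => x n - y) := by
  simp [uniformCoveringSet]

theorem ae_mem_uniformCoveringSet_iff (r : ℕ+ → ℝ) (y : UnitAddCircle) :
    (∀ᵐ x ∂iidUniform, y ∈ uniformCoveringSet r x) ↔
      ∀ᵐ x ∂iidUniform, 0 ∈ uniformCoveringSet r x := by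
  simp_rw [mem_uniformCoveringSet_iff_sub r _ y]
  conv_rhs => rw [← iidUniform_map_sub y]
  rw [ae_map_iff (Measurable.aemeasurable (by fun_prop))
    (measurableSet_zero_mem_uniformCoveringSet r)]

theorem ae_notMem_uniformCoveringSet_iff (r : ℕ+ → ℝ) (y : UnitAddCircle) :
    (∀ᵐ x ∂iidUniform, y ∉ uniformCoveringSet r x) ↔
      ∀ᵐ x ∂iidUniform, 0 ∉ uniformCoveringSet r x := by
  simp_rw [mem_uniformCoveringSet_iff_sub r _ y]
  conv_rhs => rw [← iidUniform_map_sub y]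
  exact (ae_map_iff (Measurable.aemeasurable (by fun_prop))
    (measurableSet_zero_mem_uniformCoveringSet r).compl).symm

/-- Fubini exchanges "almost every sequence" with "almost every `y`"; by translation invariance the
inner statement no longer depends on `y`. -/
theorem ae_volume_uniformCoveringSet_eq_one_iff (r : ℕ+ → ℝ) :
    (∀ᵐ x ∂iidUniform, volume (uniformCoveringSet r x) = 1) ↔
      ∀ᵐ x ∂iidUniform, 0 ∈ uniformCoveringSet r x := by
  have h1 (x) : volume (uniformCoveringSet r x) = 1 ↔
      ∀ᵐ y : UnitAddCircle, y ∈ uniformCoveringSet r x :=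
    (mem_ae_iff_prob_eq_one (measurableSet_uniformCoveringSet r x)).symm
  simp_rw [h1]
  rw [Measure.ae_ae_comm (measurableSet_mem_uniformCoveringSet r)]
  simp_rw [ae_mem_uniformCoveringSet_iff]
  exact eventually_const

theorem ae_volume_uniformCoveringSet_eq_zero_iff (r : ℕ+ → ℝ) :
    (∀ᵐ x ∂iidUniform, volume (uniformCoveringSet r x) = 0) ↔
      ∀ᵐ x ∂iidUniform, 0 ∉ uniformCoveringSet r x := by
  have h1 (x) : volume (uniformCoveringSet r x) = 0 ↔
      ∀ᵐ y : UnitAddCircle, y ∉ uniformCoveringSet r x :=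
    measure_eq_zero_iff_ae_notMem
  simp_rw [h1]
  rw [Measure.ae_ae_comm (measurableSet_mem_uniformCoveringSet r).compl]
  simp_rw [ae_notMem_uniformCoveringSet_iff]
  exact eventually_const

theorem IsIIDUniform.hasLaw_iidUniform {Ω : Type u} [MeasurableSpace Ω] {P : Measure Ω}
    {ω : ℕ+ → Ω → UnitAddCircle} (h : IsIIDUniform P ω) :
    HasLaw (fun a n => ω n a) iidUniform P :=
  h.indep.hasLaw_infinitePi h.hasLaw
    (aemeasurable_pi_iff.2 fun n => (h.hasLaw n).aemeasurable)

/-- Only the joint law of the points matters. This is why the alternative in the zero-one law is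
determined by `r` alone. -/
theorem IsIIDUniform.ae_volume_uniformCoveringSet_iff {Ω : Type u} [MeasurableSpace Ω]
    {P : Measure Ω} {ω : ℕ+ → Ω → UnitAddCircle} (h : IsIIDUniform P ω) (r : ℕ+ → ℝ)
    (v : ENNReal) :
    (∀ᵐ a ∂P, volume (uniformCoveringSet r (fun n => ω n a)) = v) ↔
      ∀ᵐ x ∂iidUniform, volume (uniformCoveringSet r x) = v := by
  rw [← h.hasLaw_iidUniform.map_eq, ae_map_iff h.hasLaw_iidUniform.aemeasurable]
  exact measurable_volume_uniformCoveringSet r (measurableSet_singleton v)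

/-! ### Volumes of balls and avoidance probabilities -/

theorem measurableSet_le_norm (ρ : ℝ) : MeasurableSet {x : UnitAddCircle | ρ ≤ ‖x‖} :=
  measurableSet_le measurable_const (by fun_prop)

theorem measurableSet_norm_lt (ρ : ℝ) : MeasurableSet {x : UnitAddCircle | ‖x‖ < ρ} :=
  measurableSet_lt (by fun_prop) measurable_const

theorem volume_norm_lt (ρ : ℝ) :
    volume {x : UnitAddCircle | ‖x‖ < ρ} = ENNReal.ofReal (min 1 (2 * ρ)) := by
  have hset : ∀ ρ : ℝ, volume {x : UnitAddCircle | ‖x‖ ≤ ρ} = ENNReal.ofReal (min 1 (2 * ρ)) := by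
    intro ρ
    have h := AddCircle.volume_closedBall (T := 1) (x := 0) ρ
    rw [← h]
    congr 1
    ext x
    simp
  refine le_antisymm ((measure_mono fun x (hx : ‖x‖ < ρ) => hx.le).trans_eq (hset ρ)) ?_
  -- The open ball is exhausted from inside by closed balls of radius `s < ρ`, and the volume
  -- formula is continuous.
  have hlim : Tendsto (fun s : ℝ => ENNReal.ofReal (min 1 (2 * s))) (nhdsWithin ρ (Set.Iio ρ))
      (nhds (ENNReal.ofReal (min 1 (2 * ρ)))) :=
    ((ENNReal.continuous_ofReal.comp (by fun_prop : Continuous fun s : ℝ => min 1 (2 * s))).tendsto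
      ρ).mono_left nhdsWithin_le_nhds
  refine le_of_tendsto hlim ?_
  filter_upwards [self_mem_nhdsWithin] with s hs
  rw [← hset s]
  exact measure_mono fun x (hx : ‖x‖ ≤ s) => hx.trans_lt hs

theorem volume_le_norm {ρ : ℝ} (hρ : 0 ≤ ρ) :
    volume {x : UnitAddCircle | ρ ≤ ‖x‖} = ENNReal.ofReal (1 - min 1 (2 * ρ)) := by
  have : {x : UnitAddCircle | ρ ≤ ‖x‖} = {x : UnitAddCircle | ‖x‖ < ρ}ᶜ := by
    ext x; simp
  rw [this, prob_compl_eq_one_sub (measurableSet_norm_lt ρ),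
    volume_norm_lt, ENNReal.ofReal_sub _ (by positivity), ENNReal.ofReal_one]

theorem volume_le_norm_lt {ρ ρ' : ℝ} (hρ : 0 ≤ ρ) (h : ρ ≤ ρ') :
    volume {x : UnitAddCircle | ρ ≤ ‖x‖ ∧ ‖x‖ < ρ'} =
      ENNReal.ofReal (min 1 (2 * ρ') - min 1 (2 * ρ)) := by
  have : {x : UnitAddCircle | ρ ≤ ‖x‖ ∧ ‖x‖ < ρ'} =
      {x : UnitAddCircle | ‖x‖ < ρ'} \ {x : UnitAddCircle | ‖x‖ < ρ} := by
    ext x; simp [and_comm]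
  have hsub : {x : UnitAddCircle | ‖x‖ < ρ} ⊆ {x : UnitAddCircle | ‖x‖ < ρ'} :=
    fun x (hx : ‖x‖ < ρ) => hx.trans_le h
  rw [this, measure_sdiff hsub (measurableSet_norm_lt ρ).nullMeasurableSet (measure_ne_top _ _),
    volume_norm_lt, volume_norm_lt, ENNReal.ofReal_sub _ (by positivity)]

/-- The set of sequences none of whose first `N` points is closer to `0` than `ρ`. -/
def avoiding (ρ : ℝ) (N : ℕ+) : Set (ℕ+ → UnitAddCircle) :=
  {x | ∀ n ≤ N, ρ ≤ ‖x n‖}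

theorem avoiding_eq_pi (ρ : ℝ) (N : ℕ+) :
    avoiding ρ N = Set.pi (Finset.Iic N) (fun _ => {x : UnitAddCircle | ρ ≤ ‖x‖}) := by
  ext x; simp [avoiding]

theorem measurableSet_avoiding (ρ : ℝ) (N : ℕ+) : MeasurableSet (avoiding ρ N) := by
  rw [avoiding_eq_pi]
  exact .pi (Finset.countable_toSet _) fun _ _ => measurableSet_le_norm ρ

theorem PNat.card_Iic (N : ℕ+) : (Finset.Iic N).card = N := by
  have : Finset.Iic N = Finset.Icc 1 N := by ext; simp
  rw [this, PNat.card_Icc]; simp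

theorem iidUniform_avoiding {ρ : ℝ} (hρ : 0 ≤ ρ) (N : ℕ+) :
    iidUniform (avoiding ρ N) = ENNReal.ofReal ((1 - min 1 (2 * ρ)) ^ (N : ℕ)) := by
  have h := Measure.infinitePi_pi (fun _ : ℕ+ => (volume : Measure UnitAddCircle))
    (s := Finset.Iic N) (t := fun _ => {x : UnitAddCircle | ρ ≤ ‖x‖})
    fun _ _ => measurableSet_le_norm ρ
  rw [avoiding_eq_pi, iidUniform, h, Finset.prod_const, volume_le_norm hρ, PNat.card_Iic,
    ENNReal.ofReal_pow (sub_nonneg.2 (min_le_left _ _))]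

theorem zero_notMem_uniformCoveringSet_iff (r : ℕ+ → ℝ) (x : ℕ+ → UnitAddCircle) :
    0 ∉ uniformCoveringSet r x ↔ ∃ᶠ N in atTop, x ∈ avoiding (r N) N := by
  simp [uniformCoveringSet, avoiding, Filter.Frequently]

/-! ### The zero-one law -/

theorem ae_zero_mem_of_forall_le {r : ℕ+ → ℝ} {δ : ℝ} (hδ : 0 < δ) (h : ∀ n, δ ≤ r n) :
    ∀ᵐ x ∂iidUniform, 0 ∈ uniformCoveringSet r x := by
  have hlt : 1 - min 1 (2 * δ) < 1 := by
    have : 0 < min 1 (2 * δ) := by positivity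
    linarith
  have hnn : 0 ≤ 1 - min 1 (2 * δ) := sub_nonneg.2 (min_le_left _ _)
  have h0 : iidUniform (⋂ N, avoiding δ N) = 0 := by
    have hlim : Tendsto (fun N : ℕ => ENNReal.ofReal ((1 - min 1 (2 * δ)) ^ N)) atTop (nhds 0) := by
      rw [← ENNReal.ofReal_zero]
      exact (ENNReal.continuous_ofReal.tendsto 0).comp
        (tendsto_pow_atTop_nhds_zero_of_lt_one hnn hlt)
    have := ge_of_tendsto hlim (b := iidUniform (⋂ N, avoiding δ N)) ?_
    · simpa using this
    · filter_upwards [eventually_gt_atTop 0] with N hN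
      lift N to ℕ+ using hN
      rw [← iidUniform_avoiding hδ.le]
      exact measure_mono (Set.iInter_subset _ _)
  filter_upwards [measure_eq_zero_iff_ae_notMem.1 h0] with x hx
  simp only [Set.mem_iInter, avoiding, Set.mem_ofPred_eq, not_forall, not_le] at hx
  obtain ⟨N, n, hn, hx⟩ := hx
  filter_upwards [eventually_ge_atTop n] with M hM
  exact ⟨n, hM, by simpa using hx.trans_le (h M)⟩

theorem tendsto_zero_or_exists_forall_le {r : ℕ+ → ℝ} (hr : ∀ n, 0 < r n) (ha : Antitone r) :
    Tendsto r atTop (nhds 0) ∨ ∃ δ > 0, ∀ n, δ ≤ r n := by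
  have hb : BddBelow (Set.range r) := ⟨0, by rintro _ ⟨n, rfl⟩; exact (hr n).le⟩
  have h := tendsto_atTop_ciInf ha hb
  rcases (le_ciInf fun n => (hr n).le : 0 ≤ ⨅ n, r n).eq_or_lt with h0 | h0
  · exact .inl (h0 ▸ h)
  · exact .inr ⟨_, h0, ciInf_le hb⟩

theorem ae_ne_zero : ∀ᵐ x ∂iidUniform, ∀ n, 0 < ‖x n‖ := by
  rw [ae_all_iff]
  intro n
  have h : ∀ᵐ y : UnitAddCircle, 0 < ‖y‖ := by
    have := AddCircle.volume_closedBall (T := 1) (x := 0) 0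
    rw [mul_zero, min_eq_right zero_le_one, ENNReal.ofReal_zero] at this
    filter_upwards [measure_eq_zero_iff_ae_notMem.1 this] with y hy
    simpa using hy
  exact (measurePreserving_eval_infinitePi (fun _ : ℕ+ => (volume : Measure UnitAddCircle))
    n).quasiMeasurePreserving.ae h

/-- **Zero-one law** for the event that `0` is uniformly covered. -/
theorem ae_zero_mem_or_ae_zero_notMem {r : ℕ+ → ℝ} (hr : ∀ n, 0 < r n) (ha : Antitone r) :
    (∀ᵐ x ∂iidUniform, 0 ∈ uniformCoveringSet r x) ∨
      ∀ᵐ x ∂iidUniform, 0 ∉ uniformCoveringSet r x := by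
  rcases tendsto_zero_or_exists_forall_le hr ha with h0 | ⟨δ, hδ, h⟩
  swap
  · exact .inl (ae_zero_mem_of_forall_le hδ h)
  -- `T k` is the covering event with the points before index `k` discarded.
  let T : ℕ+ → Set (ℕ+ → UnitAddCircle) := fun k =>
    {x | ∀ᶠ N in atTop, ∃ n ≤ N, k ≤ n ∧ ‖x n‖ < r N}
  have hT : Antitone T := fun k l hkl x hx => by
    filter_upwards [hx] with N ⟨n, h1, h2, h3⟩ using ⟨n, h1, hkl.trans h2, h3⟩
  let s : ℕ+ → MeasurableSpace (ℕ+ → UnitAddCircle) := fun n =>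
    MeasurableSpace.comap (fun x => x n) inferInstance
  have hTm (k : ℕ+) : MeasurableSet[⨆ n ≥ k, s n] (T k) := by
    have : T k = ⋃ K : ℕ+, ⋂ N : ℕ+, ⋂ _ : K ≤ N, ⋃ n : ℕ+, ⋃ _ : n ≤ N, ⋃ _ : k ≤ n,
        {x | ‖x n‖ < r N} := by
      ext p
      simp only [T, eventually_atTop, Set.mem_ofPred_eq, Set.mem_iUnion, Set.mem_iInter,
        exists_prop]
    rw [this]
    refine .iUnion fun K => .iInter fun N => .iInter fun _ => .iUnion fun n => .iUnion fun _ =>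
      .iUnion fun hk => ?_
    have hle : s n ≤ ⨆ n ≥ k, s n := le_iSup₂_of_le n hk le_rfl
    exact hle _ ⟨_, measurableSet_norm_lt (r N), rfl⟩
  have htail : MeasurableSet[limsup s atTop] (⋂ k, T k) := by
    have hlimsup : limsup s atTop = ⨅ k, ⨆ n ≥ k, s n := by
      rw [atTop_basis.limsup_eq_iInf_iSup]; simp
    rw [hlimsup, MeasurableSpace.measurableSet_iInf]
    intro k
    -- Since `T` decreases, its first terms can be dropped, leaving only events determined by the
    -- coordinates from `k` on.
    have : ⋂ k, T k = ⋂ l, T (max k l) := by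
      refine subset_antisymm (Set.subset_iInter fun l => Set.iInter_subset _ _) ?_
      exact Set.iInter_mono fun l => hT (le_max_right k l)
    rw [this]
    refine .iInter fun l => ?_
    have hle : ⨆ n ≥ max k l, s n ≤ ⨆ n ≥ k, s n :=
      biSup_mono fun n hn => (le_max_left k l).trans hn
    exact hle _ (hTm _)
  have hae : ∀ᵐ x ∂iidUniform, (x ∈ ⋂ k, T k) ↔ 0 ∈ uniformCoveringSet r x := by
    filter_upwards [ae_ne_zero] with x hx
    have h1 : 0 ∈ uniformCoveringSet r x ↔ ∀ᶠ N in atTop, ∃ n ≤ N, ‖x n‖ < r N := by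
      simp [uniformCoveringSet]
    rw [h1]
    refine ⟨fun h => ?_, fun h => Set.mem_iInter.2 fun k => ?_⟩
    · filter_upwards [Set.mem_iInter.1 h 1] with N ⟨n, h1, _, h2⟩ using ⟨n, h1, h2⟩
    -- The first `k` points are nonzero, so the shrinking ball eventually excludes all of them and
    -- the hit must come from a later index.
    · have hsmall : ∀ᶠ N in atTop, ∀ n ∈ Finset.Iic k, r N < ‖x n‖ :=
        (Finset.eventually_all _).2 fun n _ => h0.eventually (gt_mem_nhds (hx n))
      filter_upwards [h, hsmall] with N ⟨n, h1, h2⟩ h3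
      refine ⟨n, h1, ?_, h2⟩
      by_contra hkn
      exact (h3 n (Finset.mem_Iic.2 (not_le.1 hkn).le)).not_gt h2
  have hindep : iIndep s iidUniform := by
    have := iIndepFun_infinitePi (P := fun _ : ℕ+ => (volume : Measure UnitAddCircle))
      (X := fun _ x => x) (fun _ => measurable_id)
    exact this
  have hle (n : ℕ+) : s n ≤ (inferInstance : MeasurableSpace (ℕ+ → UnitAddCircle)) :=
    (measurable_pi_apply n).comap_le
  have hm : MeasurableSet (⋂ k, T k) := .iInter fun k => (iSup₂_le fun n _ => hle n) _ (hTm k)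
  rcases measure_zero_or_one_of_measurableSet_limsup_atTop hle hindep htail with h | h
  · right
    filter_upwards [hae, measure_eq_zero_iff_ae_notMem.1 h] with x h1 h2
    rwa [← h1]
  · left
    filter_upwards [hae, (mem_ae_iff_prob_eq_one hm).2 h] with x h1 h2
    rwa [← h1]

/-! ### Lower bounds for the probability of infinitely many avoidances -/

theorem le_measure_frequently {α : Type*} [MeasurableSpace α] {μ : Measure α} [IsFiniteMeasure μ]
    {A : ℕ+ → Set α} (hA : ∀ N, MeasurableSet (A N)) {c : ENNReal}
    (h : ∀ m, c ≤ μ (⋃ N ≥ m, A N)) : c ≤ μ {x | ∃ᶠ N in atTop, x ∈ A N} := by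
  have hset : {x | ∃ᶠ N in atTop, x ∈ A N} = ⋂ m, ⋃ N ≥ m, A N := by
    ext x; simp [frequently_atTop]
  rw [hset]
  refine ge_of_tendsto (tendsto_measure_iInter_atTop (s := fun m => ⋃ N ≥ m, A N) (μ := μ)
    (fun m => (MeasurableSet.iUnion fun N => .iUnion fun _ => hA N).nullMeasurableSet) ?_
    ⟨1, measure_ne_top _ _⟩) (Eventually.of_forall h)
  intro m m' hm
  exact Set.iUnion_mono fun N => Set.iUnion_mono' fun hN => ⟨hm.trans hN, subset_rfl⟩

theorem not_ae_zero_mem_of_le {r : ℕ+ → ℝ} {c : ENNReal} (hc : 0 < c)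
    (h : ∀ᶠ m in atTop, c ≤ iidUniform (⋃ N ≥ m, avoiding (r N) N)) :
    ¬ ∀ᵐ x ∂iidUniform, 0 ∈ uniformCoveringSet r x := by
  intro hae
  have h' : ∀ m, c ≤ iidUniform (⋃ N ≥ m, avoiding (r N) N) := by
    intro m
    obtain ⟨m', hm', hmm⟩ := (h.and (eventually_ge_atTop m)).exists
    refine hm'.trans (measure_mono ?_)
    exact Set.iUnion_mono fun N => Set.iUnion_mono' fun hN => ⟨hmm.trans hN, subset_rfl⟩
  have h1 := le_measure_frequently (fun N => measurableSet_avoiding (r N) N) h'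
  refine (hc.trans_le h1).ne' ?_
  rw [measure_eq_zero_iff_ae_notMem]
  filter_upwards [hae] with x hx
  rw [← zero_notMem_uniformCoveringSet_iff]
  exact not_not.2 hx

/-- On this range `(1 - q) (1 + 2 q) ≥ 1`, and `1 + 2 q ≤ exp (2 q)`. -/
theorem exp_neg_two_mul_le_one_sub {q : ℝ} (h0 : 0 ≤ q) (h : q ≤ 1 / 2) :
    Real.exp (-(2 * q)) ≤ 1 - q := by
  rw [Real.exp_neg, inv_le_comm₀ (Real.exp_pos _) (by linarith)]
  refine le_trans ?_ (Real.add_one_le_exp (2 * q))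
  rw [inv_le_iff_one_le_mul₀ (by linarith)]
  nlinarith

/-- If `n * r n` is bounded then `0` is not almost surely uniformly covered. -/
theorem not_ae_zero_mem_of_mul_le {r : ℕ+ → ℝ} (hr : ∀ n, 0 < r n) {C : ℝ}
    (hC : ∀ n : ℕ+, (n : ℝ) * r n ≤ C) :
    ¬ ∀ᵐ x ∂iidUniform, 0 ∈ uniformCoveringSet r x := by
  refine not_ae_zero_mem_of_le (c := ENNReal.ofReal (Real.exp (-(4 * C)))) (by positivity) ?_
  -- For `N > 4 C` the bound on `N * r N` forces `2 * r N ≤ 1 / 2`, the range of the exponential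
  -- estimate.
  obtain ⟨K, hK⟩ := exists_nat_gt (4 * C)
  filter_upwards [eventually_ge_atTop (K.succPNat)] with N hN
  have hKN : (K : ℝ) + 1 ≤ N := by
    have : (K.succPNat : ℕ) ≤ N := hN
    rw [Nat.succPNat_coe] at this
    exact_mod_cast this
  have hr4 : 2 * r N ≤ 1 / 2 := by
    have := hC N
    by_contra! h
    nlinarith [hr N]
  refine le_trans ?_ (measure_mono (Set.subset_biUnion_of_mem (u := fun N => avoiding (r N) N)
    (le_refl N : N ∈ {n | n ≥ N})))
  rw [iidUniform_avoiding (hr N).le, min_eq_right (by linarith)]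
  refine ENNReal.ofReal_le_ofReal ?_
  calc Real.exp (-(4 * C)) ≤ Real.exp (-(2 * (2 * r N))) ^ (N : ℕ) := by
        rw [← Real.exp_nat_mul]
        refine Real.exp_le_exp.2 ?_
        linarith [hC N]
    _ ≤ (1 - 2 * r N) ^ (N : ℕ) :=
        pow_le_pow_left₀ (Real.exp_pos _).le
          (exp_neg_two_mul_le_one_sub (by linarith [hr N]) hr4) _

/-! ### First-hit events -/

/-- The set of sequences whose first `N` points avoid the ball of radius `ρ` about `0`
while the next point hits it. -/
def firstHit (ρ : ℝ) (N : ℕ+) : Set (ℕ+ → UnitAddCircle) :=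
  avoiding ρ N ∩ {x | ‖x (N + 1)‖ < ρ}

theorem measurableSet_firstHit (ρ : ℝ) (N : ℕ+) : MeasurableSet (firstHit ρ N) :=
  (measurableSet_avoiding ρ N).inter
    (measurableSet_lt (measurable_pi_apply (N + 1)).norm measurable_const)

theorem PNat.Iic_add_one (N : ℕ+) : Finset.Iic (N + 1) = insert (N + 1) (Finset.Iic N) := by
  ext n
  simp [le_iff_lt_or_eq (b := N + 1), or_comm]

theorem PNat.prod_Iic_add_one {β : Type*} [CommMonoid β] (f : ℕ+ → β) (N : ℕ+) :
    ∏ n ∈ Finset.Iic (N + 1), f n = f (N + 1) * ∏ n ∈ Finset.Iic N, f n := by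
  rw [PNat.Iic_add_one, Finset.prod_insert]
  simp

theorem iidUniform_pi (s : Finset ℕ+) {t : ℕ+ → Set UnitAddCircle}
    (ht : ∀ n ∈ s, MeasurableSet (t n)) :
    iidUniform (Set.pi s t) = ∏ n ∈ s, volume (t n) :=
  Measure.infinitePi_pi (fun _ : ℕ+ => (volume : Measure UnitAddCircle)) ht

theorem iidUniform_firstHit {ρ : ℝ} (hρ : 0 ≤ ρ) (N : ℕ+) :
    iidUniform (firstHit ρ N) =
      ENNReal.ofReal ((1 - min 1 (2 * ρ)) ^ (N : ℕ) * min 1 (2 * ρ)) := by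
  let t : ℕ+ → Set UnitAddCircle := fun n => if n ≤ N then {x | ρ ≤ ‖x‖} else {x | ‖x‖ < ρ}
  have hset : firstHit ρ N = Set.pi (Finset.Iic (N + 1)) t := by
    ext x
    simp only [firstHit, avoiding, Set.mem_inter_iff, Set.mem_ofPred_eq, Set.mem_pi,
      Finset.coe_Iic, Set.mem_Iic, t]
    refine ⟨fun h n hn => ?_, fun h => ⟨fun n hn => ?_, ?_⟩⟩
    · split_ifs with hnN
      · exact h.1 n hnN
      · have : n = N + 1 := le_antisymm hn (PNat.add_one_le_iff.2 (not_le.1 hnN))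
        subst this
        exact h.2
    · have := h n (hn.trans (PNat.lt_add_right N 1).le)
      rwa [if_pos hn] at this
    · have := h (N + 1) le_rfl
      rwa [if_neg (PNat.lt_add_right N 1).not_ge] at this
  have ht : ∀ n ∈ Finset.Iic (N + 1), MeasurableSet (t n) := by
    intro n _
    simp only [t]
    split_ifs
    exacts [measurableSet_le_norm ρ, measurableSet_norm_lt ρ]
  rw [hset, iidUniform_pi _ ht, PNat.prod_Iic_add_one]
  have h1 : ∏ n ∈ Finset.Iic N, volume (t n) =
      ∏ n ∈ Finset.Iic N, volume {x : UnitAddCircle | ρ ≤ ‖x‖} :=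
    Finset.prod_congr rfl fun n hn => by simp only [t]; rw [if_pos (Finset.mem_Iic.1 hn)]
  have h2 : t (N + 1) = {x | ‖x‖ < ρ} := if_neg (PNat.lt_add_right N 1).not_ge
  rw [h1, h2, Finset.prod_const, volume_le_norm hρ, PNat.card_Iic, volume_norm_lt,
    ← ENNReal.ofReal_pow (sub_nonneg.2 (min_le_left _ _)),
    ← ENNReal.ofReal_mul (by positivity), mul_comm]

theorem one_sub_min_le_exp_neg (ρ : ℝ) : 1 - min 1 (2 * ρ) ≤ Real.exp (-(2 * ρ)) := by
  rcases le_total 1 (2 * ρ) with h | h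
  · rw [min_eq_left h, sub_self]
    exact (Real.exp_pos _).le
  · rw [min_eq_right h]
    exact Real.one_sub_le_exp_neg _

theorem one_sub_min_pow_le_exp {ρ : ℝ} (N : ℕ) :
    (1 - min 1 (2 * ρ)) ^ N ≤ Real.exp (-2 * N * ρ) := by
  calc (1 - min 1 (2 * ρ)) ^ N ≤ Real.exp (-(2 * ρ)) ^ N :=
        pow_le_pow_left₀ (sub_nonneg.2 (min_le_left _ _)) (one_sub_min_le_exp_neg ρ) N
    _ = _ := by rw [← Real.exp_nat_mul]; congr 1; ring

/-! ### The convergence half -/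

theorem ae_zero_mem_of_summable {r : ℕ+ → ℝ} (hr : ∀ n, 0 < r n) (ha : Antitone r)
    (hs : Summable fun n : ℕ+ => r n * Real.exp (-2 * (n : ℝ) * r n))
    (ht : Tendsto (fun n : ℕ+ => (n : ℝ) * r n) atTop atTop) :
    ∀ᵐ x ∂iidUniform, 0 ∈ uniformCoveringSet r x := by
  have hsum : ∑' N, iidUniform (firstHit (r N) N) ≠ ⊤ := by
    have h2 := (hs.mul_left 2).tsum_ofReal_ne_top
    refine ne_top_of_le_ne_top h2 (ENNReal.tsum_le_tsum fun N => ?_)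
    rw [iidUniform_firstHit (hr N).le]
    refine ENNReal.ofReal_le_ofReal ?_
    have h3 : min 1 (2 * r N) ≤ 2 * r N := min_le_right _ _
    have h4 : 0 ≤ min 1 (2 * r N) := le_min zero_le_one (by linarith [hr N])
    calc _ ≤ Real.exp (-2 * N * r N) * (2 * r N) :=
          mul_le_mul (one_sub_min_pow_le_exp _) h3 h4 (Real.exp_pos _).le
      _ = _ := by ring
  have hzero (K : ℕ+) : iidUniform (⋂ N ≥ K, avoiding (r N) N) = 0 := by
    have hlim : Tendsto (fun N : ℕ+ => ENNReal.ofReal (Real.exp (-2 * N * r N))) atTop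
        (nhds 0) := by
      rw [← ENNReal.ofReal_zero]
      refine (ENNReal.continuous_ofReal.tendsto 0).comp (Real.tendsto_exp_atBot.comp ?_)
      have := ht.const_mul_atTop_of_neg (show (-2 : ℝ) < 0 by norm_num)
      simpa only [mul_assoc] using this
    refine le_antisymm (ge_of_tendsto hlim ?_) zero_le
    filter_upwards [eventually_ge_atTop K] with N hN
    refine (measure_mono (Set.biInter_subset_of_mem (show N ∈ {n | n ≥ K} from hN))).trans ?_
    rw [iidUniform_avoiding (hr N).le]
    exact ENNReal.ofReal_le_ofReal (one_sub_min_pow_le_exp _)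
  have hzero' : ∀ᵐ x ∂iidUniform, ∀ K, x ∉ ⋂ N ≥ K, avoiding (r N) N :=
    ae_all_iff.2 fun K => measure_eq_zero_iff_ae_notMem.1 (hzero K)
  filter_upwards [ae_finite_setOfPred_mem hsum, hzero'] with x hfin hx
  by_contra hcon
  rw [zero_notMem_uniformCoveringSet_iff] at hcon
  have hev : ∀ᶠ N in atTop, x ∉ firstHit (r N) N :=
    atTop_le_cofinite hfin.compl_mem_cofinite
  obtain ⟨K, hK⟩ := eventually_atTop.1 hev
  obtain ⟨L, hL, hxL⟩ := frequently_atTop.1 hcon K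
  -- With no first hit after `K`, avoidance at `L` propagates by induction to every `N ≥ L`: the
  -- next point also stays outside the ball, and the ball only shrinks.
  refine hx L (Set.mem_iInter₂.2 fun N hN => ?_)
  induction N using PNat.recOn with
  | one => rwa [le_antisymm hN (one_le)] at hxL
  | succ N ih =>
    rcases hN.lt_or_eq with h | h
    · have hLN : L ≤ N := PNat.lt_add_one_iff.1 h
      have h1 := ih hLN
      have h2 : r N ≤ ‖x (N + 1)‖ := by
        by_contra! h3
        exact hK N (hL.trans hLN) ⟨h1, h3⟩
      intro n hn
      refine (ha (PNat.lt_add_right N 1).le).trans ?_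
      rcases hn.lt_or_eq with h3 | h3
      · exact h1 n (PNat.lt_add_one_iff.1 h3)
      · rwa [h3]
    · rwa [← h]

/-! ### The divergence half: second moments and quasi-independence -/

/-- A Chung–Erdős type bound. With `f` the number of events that occur, `2 f / t - f ^ 2 / t ^ 2` is
at most the indicator of the union; integrating gives the claim. -/
theorem half_inv_le_measureReal_biUnion {α ι : Type*} [MeasurableSpace α] {μ : Measure α}
    [IsProbabilityMeasure μ] {G : ι → Set α} (hG : ∀ i, MeasurableSet (G i)) (s : Finset ι)
    {C : ℝ} (hC : 0 < C) (hS : 1 ≤ ∑ i ∈ s, μ.real (G i))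
    (h : ∑ i ∈ s, ∑ j ∈ s, μ.real (G i ∩ G j) ≤
      C * (∑ i ∈ s, μ.real (G i) + (∑ i ∈ s, μ.real (G i)) ^ 2)) :
    (2 * C)⁻¹ ≤ μ.real (⋃ i ∈ s, G i) := by
  set S := ∑ i ∈ s, μ.real (G i) with hSdef
  have hint (A : Set α) (hA : MeasurableSet A) : Integrable (A.indicator fun _ => (1 : ℝ)) μ :=
    (integrable_const 1).indicator hA
  have hint' (A : Set α) (hA : MeasurableSet A) :
      ∫ x, A.indicator (fun _ => (1 : ℝ)) x ∂μ = μ.real A := by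
    rw [integral_indicator hA]; simp
  have hU : MeasurableSet (⋃ i ∈ s, G i) := s.measurableSet_biUnion fun i _ => hG i
  let f : α → ℝ := fun x => ∑ i ∈ s, (G i).indicator (fun _ => 1) x
  let f2 : α → ℝ := fun x => ∑ i ∈ s, ∑ j ∈ s, (G i ∩ G j).indicator (fun _ => 1) x
  have hf : Integrable f μ := integrable_finsetSum _ fun i _ => hint _ (hG i)
  have hf2 : Integrable f2 μ := integrable_finsetSum _ fun i _ =>
    integrable_finsetSum _ fun j _ => hint _ ((hG i).inter (hG j))
  have hEf : ∫ x, f x ∂μ = S := by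
    rw [integral_finsetSum _ fun i _ => hint _ (hG i)]
    exact Finset.sum_congr rfl fun i _ => hint' _ (hG i)
  have hEf2 : ∫ x, f2 x ∂μ = ∑ i ∈ s, ∑ j ∈ s, μ.real (G i ∩ G j) := by
    rw [integral_finsetSum _ fun i _ => integrable_finsetSum _ fun j _ =>
      hint _ ((hG i).inter (hG j))]
    refine Finset.sum_congr rfl fun i _ => ?_
    rw [integral_finsetSum _ fun j _ => hint _ ((hG i).inter (hG j))]
    exact Finset.sum_congr rfl fun j _ => hint' _ ((hG i).inter (hG j))
  have hff (x : α) : f2 x = f x ^ 2 := by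
    simp only [f, f2, sq, Finset.sum_mul_sum]
    refine Finset.sum_congr rfl fun i _ => Finset.sum_congr rfl fun j _ => ?_
    by_cases h1 : x ∈ G i <;> by_cases h2 : x ∈ G j <;> simp [h1, h2]
  -- This `t` maximises `2 S / t - 2 C S ^ 2 / t ^ 2`, with value `1 / (2 C)`.
  set t := 2 * C * S with ht
  have htpos : 0 < t := by positivity
  have hpt (x : α) : 2 * t⁻¹ * f x - t⁻¹ ^ 2 * f2 x ≤
      (⋃ i ∈ s, G i).indicator (fun _ => (1 : ℝ)) x := by
    rw [hff]
    by_cases hx : x ∈ ⋃ i ∈ s, G i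
    · rw [Set.indicator_of_mem hx]
      nlinarith [sq_nonneg (t⁻¹ * f x - 1)]
    · rw [Set.indicator_of_notMem hx]
      have : f x = 0 := Finset.sum_eq_zero fun i hi =>
        Set.indicator_of_notMem (fun h => hx (Set.mem_biUnion hi h)) _
      simp [this]
  have hmono := integral_mono ((hf.const_mul (2 * t⁻¹)).sub (hf2.const_mul (t⁻¹ ^ 2)))
    (hint _ hU) hpt
  rw [hint' _ hU] at hmono
  refine le_trans ?_ hmono
  simp only [Pi.sub_apply]
  rw [integral_sub (hf.const_mul _) (hf2.const_mul _), integral_const_mul, integral_const_mul,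
    hEf, hEf2]
  have hS0 : 0 < S := by linarith
  have hbound : ∑ i ∈ s, ∑ j ∈ s, μ.real (G i ∩ G j) ≤ 2 * C * S ^ 2 := by
    refine h.trans ?_
    have : S ≤ S ^ 2 := by nlinarith
    nlinarith
  have h1 : t⁻¹ ^ 2 * ∑ i ∈ s, ∑ j ∈ s, μ.real (G i ∩ G j) ≤ t⁻¹ ^ 2 * (2 * C * S ^ 2) :=
    mul_le_mul_of_nonneg_left hbound (by positivity)
  have h2 : 2 * t⁻¹ * S - t⁻¹ ^ 2 * (2 * C * S ^ 2) = (2 * C)⁻¹ := by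
    rw [ht]; field_simp; ring
  linarith

/-- On the intersection, point `M + 1` lies in the annulus between the two radii: it hits the larger
ball but must still avoid the smaller one. The remaining constraints are also on separate
coordinates, so the bound is a product. -/
theorem iidUniform_firstHit_inter_le {ρ ρ' : ℝ} (hρ : 0 ≤ ρ) (h : ρ ≤ ρ') {M N : ℕ+}
    (hMN : M < N) :
    iidUniform (firstHit ρ' M ∩ firstHit ρ N) ≤
      ENNReal.ofReal ((1 - min 1 (2 * ρ')) ^ (M : ℕ) * (min 1 (2 * ρ') - min 1 (2 * ρ)) *
        (1 - min 1 (2 * ρ)) ^ ((N : ℕ) - M - 1) * min 1 (2 * ρ)) := by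
  let t : ℕ+ → Set UnitAddCircle := fun n =>
    if n ≤ M then {x | ρ' ≤ ‖x‖} else if n = M + 1 then {x | ρ ≤ ‖x‖ ∧ ‖x‖ < ρ'} else
      if n ≤ N then {x | ρ ≤ ‖x‖} else {x | ‖x‖ < ρ}
  have hM1 : ¬ M + 1 ≤ M := (PNat.lt_add_right M 1).not_ge
  have hMN' : M + 1 ≤ N := PNat.add_one_le_iff.2 hMN
  have hsub : firstHit ρ' M ∩ firstHit ρ N ⊆ Set.pi (Finset.Iic (N + 1)) t := by
    rintro x ⟨⟨h1, h2⟩, h3, h4⟩ n hn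
    simp only [Finset.coe_Iic, Set.mem_Iic] at hn
    simp only [t]
    split_ifs with hn1 hn2 hn3
    · exact h1 n hn1
    · subst hn2
      exact ⟨h3 _ hMN', h2⟩
    · exact h3 n hn3
    · have : n = N + 1 := le_antisymm hn (PNat.add_one_le_iff.2 (not_le.1 hn3))
      subst this
      exact h4
  have hmeas : ∀ n ∈ Finset.Iic (N + 1), MeasurableSet (t n) := by
    intro n _
    simp only [t]
    split_ifs
    exacts [measurableSet_le_norm ρ', (measurableSet_le_norm ρ).inter (measurableSet_norm_lt ρ'),
      measurableSet_le_norm ρ, measurableSet_norm_lt ρ]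
  refine (measure_mono hsub).trans_eq ?_
  rw [iidUniform_pi _ hmeas, PNat.prod_Iic_add_one]
  have hsplit : Finset.Iic N = Finset.Iic (M + 1) ∪ Finset.Ioc (M + 1) N := by
    ext n
    simp only [Finset.mem_Iic, Finset.mem_union, Finset.mem_Ioc]
    constructor
    · intro hn
      rcases le_or_gt n (M + 1) with h | h
      exacts [.inl h, .inr ⟨h, hn⟩]
    · rintro (h | h)
      exacts [h.trans hMN', h.2]
  have hdisj : Disjoint (Finset.Iic (M + 1)) (Finset.Ioc (M + 1) N) := by
    rw [Finset.disjoint_left]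
    intro n h1 h2
    exact (Finset.mem_Ioc.1 h2).1.not_ge (Finset.mem_Iic.1 h1)
  rw [hsplit, Finset.prod_union hdisj, PNat.prod_Iic_add_one]
  have e1 : ∏ n ∈ Finset.Iic M, volume (t n) =
      ∏ n ∈ Finset.Iic M, volume {x : UnitAddCircle | ρ' ≤ ‖x‖} :=
    Finset.prod_congr rfl fun n hn => by simp only [t]; rw [if_pos (Finset.mem_Iic.1 hn)]
  have e2 : t (M + 1) = {x | ρ ≤ ‖x‖ ∧ ‖x‖ < ρ'} := by
    simp only [t]; rw [if_neg hM1, if_pos trivial]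
  have e3 : ∏ n ∈ Finset.Ioc (M + 1) N, volume (t n) =
      ∏ n ∈ Finset.Ioc (M + 1) N, volume {x : UnitAddCircle | ρ ≤ ‖x‖} := by
    refine Finset.prod_congr rfl fun n hn => ?_
    rw [Finset.mem_Ioc] at hn
    simp only [t]
    rw [if_neg ((PNat.lt_add_right M 1).trans hn.1).not_ge, if_neg hn.1.ne', if_pos hn.2]
  have e4 : t (N + 1) = {x | ‖x‖ < ρ} := by
    simp only [t]
    have hN1 : N < N + 1 := PNat.lt_add_right N 1
    rw [if_neg (hMN.trans hN1).not_ge, if_neg (hMN'.trans_lt hN1).ne', if_neg hN1.not_ge]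
  have hcard : (Finset.Ioc (M + 1) N).card = (N : ℕ) - M - 1 := by
    rw [PNat.card_Ioc, PNat.add_coe, PNat.one_coe, Nat.sub_sub]
  have hp : 0 ≤ 1 - min 1 (2 * ρ) := sub_nonneg.2 (min_le_left _ _)
  have hp' : 0 ≤ 1 - min 1 (2 * ρ') := sub_nonneg.2 (min_le_left _ _)
  have hd : 0 ≤ min 1 (2 * ρ') - min 1 (2 * ρ) :=
    sub_nonneg.2 (min_le_min le_rfl (by linarith))
  rw [e1, e2, e3, e4, Finset.prod_const, Finset.prod_const, volume_le_norm hρ,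
    volume_le_norm (hρ.trans h), volume_le_norm_lt hρ h, volume_norm_lt, PNat.card_Iic, hcard,
    ← ENNReal.ofReal_pow hp, ← ENNReal.ofReal_pow hp', ← ENNReal.ofReal_mul hd,
    ← ENNReal.ofReal_mul (by positivity), ← ENNReal.ofReal_mul (by positivity)]
  congr 1
  ring

/-- Compared with independence only the factor `(1 - q) ^ (M + 1)` is missing, and it is at least
`exp (-4)` when `M * q ≤ 1`. -/
theorem pair_bound_of_mul_le_one {p q : ℝ} {M N : ℕ} (hq : 0 < q) (hqp : q ≤ p) (hp : p ≤ 1 / 2)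
    (hMq : M * q ≤ 1) (hMN : M < N) :
    (1 - p) ^ M * (p - q) * (1 - q) ^ (N - M - 1) * q ≤
      Real.exp 4 * ((1 - p) ^ M * p) * ((1 - q) ^ N * q) := by
  have h1 : 1 ≤ Real.exp 4 * (1 - q) ^ (M + 1) := by
    have h2 : Real.exp (-4) ≤ (1 - q) ^ (M + 1) := by
      calc Real.exp (-4) ≤ Real.exp (-(2 * q)) ^ (M + 1) := by
            rw [← Real.exp_nat_mul]
            refine Real.exp_le_exp.2 ?_
            push_cast
            nlinarith
        _ ≤ _ := pow_le_pow_left₀ (Real.exp_pos _).le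
              (exp_neg_two_mul_le_one_sub hq.le (by linarith)) _
    calc 1 = Real.exp 4 * Real.exp (-4) := by rw [← Real.exp_add]; simp
      _ ≤ _ := by gcongr
  have h3 : (1 - q) ^ N = (1 - q) ^ (N - M - 1) * (1 - q) ^ (M + 1) := by
    rw [← pow_add]; congr 1; omega
  have hp0 : 0 ≤ 1 - p := by linarith
  have hq0 : 0 ≤ 1 - q := by linarith
  calc (1 - p) ^ M * (p - q) * (1 - q) ^ (N - M - 1) * q
      ≤ (1 - p) ^ M * p * (1 - q) ^ (N - M - 1) * q := by gcongr; linarith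
    _ = (1 - p) ^ M * p * (1 - q) ^ (N - M - 1) * q * 1 := by ring
    _ ≤ (1 - p) ^ M * p * (1 - q) ^ (N - M - 1) * q * (Real.exp 4 * (1 - q) ^ (M + 1)) := by
        gcongr
        exact mul_nonneg (mul_nonneg (mul_nonneg (by positivity) (by linarith)) (by positivity))
          hq.le
    _ = _ := by rw [h3]; ring

/-- Here the thinness of the annulus gives the gain: `M p ≤ N q` makes `p - q` at most `p (N - M) /
M`, and the decay in `N - M` of the avoidance factor absorbs `N - M`. -/
theorem pair_bound_of_one_le_mul {p q : ℝ} {M N : ℕ} (hq : 0 < q) (hqp : q ≤ p) (hp : p ≤ 1 / 2)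
    (hMq : 1 ≤ M * q) (hpq : M * p ≤ N * q) (hMN : M < N) :
    (1 - p) ^ M * (p - q) * (1 - q) ^ (N - M - 1) * q ≤
      (1 - p) ^ M * p * (4 / M * Real.exp (-(1 / (2 * M))) ^ (N - M)) := by
  have hM0 : 0 < (M : ℝ) := by
    rcases Nat.eq_zero_or_pos M with h | h
    · subst h; norm_num at hMq
    · exact_mod_cast h
  obtain ⟨j, rfl⟩ := Nat.exists_eq_add_of_lt hMN
  have e1 : M + j + 1 - M - 1 = j := by omega
  have e2 : M + j + 1 - M = j + 1 := by omega
  rw [e1, e2]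
  push_cast at hpq
  have hp0 : 0 ≤ 1 - p := by linarith
  have hq0 : 0 ≤ 1 - q := by linarith
  have hj : (0 : ℝ) < j + 1 := by positivity
  have hdiff : p - q ≤ p * ((j + 1) / M) := by
    have : p - q ≤ q * ((j + 1) / M) := by
      rw [mul_div_assoc', le_div_iff₀ hM0]; nlinarith
    exact this.trans (by gcongr)
  have hpow : (1 - q) ^ j ≤ 2 * Real.exp (-(q * (j + 1))) := by
    calc (1 - q) ^ j ≤ Real.exp (-q) ^ j := pow_le_pow_left₀ hq0 (Real.one_sub_le_exp_neg q) j
      _ = Real.exp q * Real.exp (-(q * (j + 1))) := by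
          rw [← Real.exp_nat_mul, ← Real.exp_add]; congr 1; ring
      _ ≤ 2 * Real.exp (-(q * (j + 1))) := by
          gcongr
          have h1 := exp_neg_two_mul_le_one_sub (q := q / 2) (by linarith) (by linarith)
          have h2 : Real.exp q * Real.exp (-(2 * (q / 2))) = 1 := by
            rw [← Real.exp_add]; ring_nf; exact Real.exp_zero
          have h3 := Real.one_sub_le_exp_neg q
          have h4 : Real.exp q * Real.exp (-q) = 1 := by rw [← Real.exp_add]; simp
          nlinarith [Real.exp_pos q]
  -- Half of the exponent absorbs the factor `q (j + 1)`, since `x * exp (-x) ≤ 1`; the other half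
  -- decays geometrically because `q ≥ 1 / M`.
  have hexp : q * Real.exp (-(q * (j + 1))) ≤
      2 / (j + 1) * Real.exp (-(1 / (2 * M))) ^ (j + 1) := by
    have h1 : q * (j + 1) / 2 * Real.exp (-(q * (j + 1) / 2)) ≤ 1 := by
      have h2 := Real.add_one_le_exp (q * (j + 1) / 2)
      have h4 : Real.exp (q * (j + 1) / 2) * Real.exp (-(q * (j + 1) / 2)) = 1 := by
        rw [← Real.exp_add]; simp
      nlinarith [Real.exp_pos (-(q * (j + 1) / 2))]
    have h3 : Real.exp (-(q * (j + 1) / 2)) ≤ Real.exp (-(1 / (2 * M))) ^ (j + 1) := by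
      rw [← Real.exp_nat_mul]
      refine Real.exp_le_exp.2 ?_
      have : 1 / (2 * (M : ℝ)) ≤ q / 2 := by
        rw [div_le_div_iff₀ (by positivity) (by norm_num)]; nlinarith
      push_cast
      nlinarith
    calc q * Real.exp (-(q * (j + 1)))
        = 2 / (j + 1) * (q * (j + 1) / 2 * Real.exp (-(q * (j + 1) / 2))) *
            Real.exp (-(q * (j + 1) / 2)) := by
          have : Real.exp (-(q * (j + 1))) =
              Real.exp (-(q * (j + 1) / 2)) * Real.exp (-(q * (j + 1) / 2)) := by
            rw [← Real.exp_add]; congr 1; ring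
          rw [this]; field_simp
      _ ≤ 2 / (j + 1) * 1 * Real.exp (-(1 / (2 * M))) ^ (j + 1) := by gcongr
      _ = _ := by ring
  have hp1 : 0 ≤ p := by linarith
  calc (1 - p) ^ M * (p - q) * (1 - q) ^ j * q
      ≤ (1 - p) ^ M * (p * ((j + 1) / M)) * (2 * Real.exp (-(q * (j + 1)))) * q := by
        gcongr
    _ = (1 - p) ^ M * p * (2 * ((j + 1) / M) * (q * Real.exp (-(q * (j + 1))))) := by ring
    _ ≤ (1 - p) ^ M * p * (2 * ((j + 1) / M) *
          (2 / (j + 1) * Real.exp (-(1 / (2 * M))) ^ (j + 1))) := by gcongr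
    _ = _ := by field_simp; ring

theorem sum_geometric_tail_le (s : Finset ℕ+) (M : ℕ+) :
    ∑ N ∈ s, (if M < N then 4 / (M : ℝ) * Real.exp (-(1 / (2 * M))) ^ ((N : ℕ) - M) else 0) ≤
      12 := by
  have hM : (1 : ℝ) ≤ M := by exact_mod_cast (one_le : (1 : ℕ+) ≤ M)
  set θ := Real.exp (-(1 / (2 * (M : ℝ)))) with hθ
  have hθ0 : 0 < θ := Real.exp_pos _
  have hθ1 : θ < 1 := by
    rw [hθ, Real.exp_lt_one_iff]
    have : 0 < 1 / (2 * (M : ℝ)) := by positivity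
    linarith
  -- From `exp x ≥ 1 + x`, `θ ≤ 2 M / (2 M + 1)`, so the inverse is at most `2 M + 1 ≤ 3 M`.
  have hθM : (1 - θ)⁻¹ ≤ 3 * M := by
    have h1 := Real.add_one_le_exp (1 / (2 * (M : ℝ)))
    have h2 : Real.exp (1 / (2 * (M : ℝ))) * θ = 1 := by rw [hθ, ← Real.exp_add]; simp
    have h3 : (1 / (2 * (M : ℝ)) + 1) * θ ≤ 1 := by nlinarith
    have h4 : 1 / (2 * (M : ℝ)) + 1 = (1 + 2 * M) / (2 * M) := by field_simp
    rw [h4, div_mul_eq_mul_div, div_le_one (by positivity)] at h3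
    rw [inv_le_iff_one_le_mul₀ (by linarith)]
    nlinarith
  rw [← Finset.sum_filter, ← Finset.mul_sum]
  have hinj : Set.InjOn (fun N : ℕ+ => (N : ℕ) - M) (s.filter (M < ·)) := by
    intro a ha b hb hab
    simp only [Finset.coe_filter, Set.mem_ofPred_eq] at ha hb
    have h1 : (M : ℕ) < a := ha.2
    have h2 : (M : ℕ) < b := hb.2
    refine PNat.eq ?_
    simp only at hab
    omega
  have hsum : ∑ N ∈ s.filter (M < ·), θ ^ ((N : ℕ) - M) ≤ (1 - θ)⁻¹ := by
    rw [← tsum_geometric_of_lt_one hθ0.le hθ1, ← Finset.sum_image (f := fun j : ℕ => θ ^ j) hinj]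
    exact (summable_geometric_of_lt_one hθ0.le hθ1).sum_le_tsum _ fun _ _ => by positivity
  calc 4 / (M : ℝ) * ∑ N ∈ s.filter (M < ·), θ ^ ((N : ℕ) - M) ≤ 4 / (M : ℝ) * (3 * M) := by
        gcongr; exact hsum.trans hθM
    _ = 12 := by field_simp; norm_num

/-- If `N p ^ 2 ≤ 1`, then `1 - p ≥ exp (-(p + 2 p ^ 2))` loses at most `exp 2` in the `N`-th power.
Otherwise `(N p) ^ 2 ≥ N`, and `exp x ≥ x ^ 4 / 24` leaves a summable error. -/
theorem mul_exp_neg_le {p : ℝ} {N : ℕ} (hN : 0 < N) (hp0 : 0 ≤ p) (hp : p ≤ 1 / 2) :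
    p * Real.exp (-(N * p)) ≤ Real.exp 2 * ((1 - p) ^ N * p) + 24 / (N : ℝ) ^ 2 := by
  have hN' : (0 : ℝ) < N := by exact_mod_cast hN
  rcases le_or_gt (N * p ^ 2) 1 with h | h
  · have h1 : Real.exp (-(p + 2 * p ^ 2)) ≤ 1 - p := by
      rw [Real.exp_neg, inv_le_comm₀ (Real.exp_pos _) (by linarith)]
      refine le_trans ?_ (Real.add_one_le_exp _)
      rw [inv_le_iff_one_le_mul₀ (by linarith)]
      nlinarith [mul_nonneg (sq_nonneg p) (by linarith : 0 ≤ 1 - 2 * p)]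
    have h2 : Real.exp (-(N * p)) ≤ Real.exp 2 * (1 - p) ^ N := by
      calc Real.exp (-(N * p)) ≤ Real.exp 2 * Real.exp (-(p + 2 * p ^ 2)) ^ N := by
            rw [← Real.exp_nat_mul, ← Real.exp_add]
            refine Real.exp_le_exp.2 ?_
            nlinarith
        _ ≤ _ := by gcongr
    have h3 : 0 ≤ 24 / (N : ℝ) ^ 2 := by positivity
    nlinarith [mul_le_mul_of_nonneg_left h2 hp0]
  · have hx : 0 ≤ N * p := by positivity
    have h1 : (N * p) ^ 4 / 24 ≤ Real.exp (N * p) := by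
      have := Real.pow_div_factorial_le_exp (N * p) hx 4
      simpa [Nat.factorial] using this
    have h2 : (N : ℝ) ^ 2 ≤ (N * p) ^ 4 := by
      have h3 : (N : ℝ) ≤ (N * p) ^ 2 := by nlinarith
      calc (N : ℝ) ^ 2 ≤ ((N * p) ^ 2) ^ 2 := by gcongr
        _ = _ := by ring
    have h4 : Real.exp (-(N * p)) ≤ 24 / (N : ℝ) ^ 2 := by
      rw [Real.exp_neg, inv_le_comm₀ (Real.exp_pos _) (by positivity), inv_div]
      exact le_trans (by gcongr) h1
    have h5 : 0 ≤ Real.exp 2 * ((1 - p) ^ N * p) := by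
      have : 0 ≤ 1 - p := by linarith
      positivity
    have h6 : p * Real.exp (-(N * p)) ≤ Real.exp (-(N * p)) :=
      mul_le_of_le_one_left (Real.exp_pos _).le (by linarith)
    linarith

theorem exists_finset_one_le_sum {ι : Type*} {a : ι → ℝ} (ha : ∀ i, 0 ≤ a i)
    (hs : ¬ Summable a) {t : Set ι} (ht : tᶜ.Finite) :
    ∃ s : Finset ι, (∀ i ∈ s, i ∈ t) ∧ 1 ≤ ∑ i ∈ s, a i := by
  classical
  by_contra! hcon
  refine hs ?_
  have h1 : Summable (t.indicator a) := by
    refine summable_of_sum_le (c := 1) (fun i => Set.indicator_nonneg (fun i _ => ha i) i)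
      fun s => ?_
    have h2 := hcon (s.filter (· ∈ t)) fun i hi => (Finset.mem_filter.1 hi).2
    rw [Finset.sum_filter] at h2
    simpa [Set.indicator_apply] using h2.le
  refine h1.congr_cofinite ?_
  filter_upwards [ht.compl_mem_cofinite] with i hi
  exact Set.indicator_of_mem (by simpa using hi) a

theorem measureReal_firstHit {ρ : ℝ} (hρ : 0 ≤ ρ) (hρ' : 2 * ρ ≤ 1) (N : ℕ+) :
    iidUniform.real (firstHit ρ N) = (1 - 2 * ρ) ^ (N : ℕ) * (2 * ρ) := by
  have h0 : 0 ≤ 1 - 2 * ρ := by linarith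
  rw [measureReal_def, iidUniform_firstHit hρ, min_eq_right hρ', ENNReal.toReal_ofReal]
  positivity

theorem measureReal_firstHit_inter_le {r : ℕ+ → ℝ} (hr : ∀ n, 0 < r n) (ha : Antitone r)
    (hm : Monotone fun n : ℕ+ => (n : ℝ) * r n) {M N : ℕ+} (hMN : M < N)
    (hM : 2 * r M ≤ 1 / 2) :
    iidUniform.real (firstHit (r M) M ∩ firstHit (r N) N) ≤
      Real.exp 4 * iidUniform.real (firstHit (r M) M) * iidUniform.real (firstHit (r N) N) +
      iidUniform.real (firstHit (r M) M) *
        (4 / (M : ℝ) * Real.exp (-(1 / (2 * M))) ^ ((N : ℕ) - M)) := by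
  have hle := ha hMN.le
  have hN := hr N
  rw [measureReal_firstHit (hr M).le (by linarith), measureReal_firstHit hN.le (by linarith)]
  have hb := iidUniform_firstHit_inter_le hN.le hle hMN
  rw [min_eq_right (by linarith), min_eq_right (by linarith)] at hb
  have h1 : 0 ≤ 1 - 2 * r M := by linarith
  have h2 : 0 ≤ 1 - 2 * r N := by linarith
  have h3 : 0 ≤ 2 * r M - 2 * r N := by linarith
  have hb' := ENNReal.toReal_le_of_le_ofReal (by positivity) hb
  rw [← measureReal_def] at hb'
  have hM0 := hr M
  have hMN' : (M : ℕ) < N := hMN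
  -- Each regime yields one of the two summands; the other is nonnegative.
  rcases le_total ((M : ℝ) * (2 * r N)) 1 with h | h
  · have := pair_bound_of_mul_le_one (p := 2 * r M) (by linarith) (by linarith) hM h hMN'
    refine (hb'.trans this).trans (le_add_of_nonneg_right ?_)
    positivity
  · have hmono : (M : ℝ) * (2 * r M) ≤ N * (2 * r N) := by
      have := hm hMN.le
      simp only at this
      linarith
    have := pair_bound_of_one_le_mul (p := 2 * r M) (by linarith) (by linarith) hM h hmono hMN'
    refine (hb'.trans this).trans (le_add_of_nonneg_left ?_)
    positivity

theorem not_summable_measureReal_firstHit {r : ℕ+ → ℝ} (hr : ∀ n, 0 < r n)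
    (h0 : Tendsto r atTop (nhds 0))
    (hs : ¬ Summable fun n : ℕ+ => r n * Real.exp (-2 * (n : ℝ) * r n)) :
    ¬ Summable fun N => iidUniform.real (firstHit (r N) N) := by
  intro h
  refine hs ?_
  have h24 : Summable fun N : ℕ+ => 24 / ((N : ℕ) : ℝ) ^ 2 := by
    have : Summable fun N : ℕ => 24 / (N : ℝ) ^ 2 := by
      simpa [div_eq_mul_inv] using (Real.summable_nat_pow_inv.2 one_lt_two).mul_left 24
    exact this.comp_injective PNat.coe_injective
  refine Summable.of_norm_bounded_eventually ((h.mul_left (Real.exp 2)).add h24) ?_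
  have hev : ∀ᶠ N in atTop, r N < 1 / 4 := h0.eventually (gt_mem_nhds (by norm_num))
  obtain ⟨K, hK⟩ := eventually_atTop.1 hev
  have hfin : (Set.Iio K).Finite := Set.finite_Iio K
  filter_upwards [hfin.compl_mem_cofinite] with N hN
  have h4 := hK N (by simpa using hN)
  have hN0 := hr N
  rw [measureReal_firstHit hN0.le (by linarith), Real.norm_of_nonneg (by positivity)]
  refine le_trans ?_ (mul_exp_neg_le N.pos (by linarith : 0 ≤ 2 * r N) (by linarith))
  have e : -2 * (N : ℝ) * r N = -((N : ℕ) * (2 * r N)) := by ring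
  rw [e]
  exact mul_le_mul_of_nonneg_right (by linarith) (Real.exp_pos _).le

theorem sum_measureReal_inter_le {α ι : Type*} [LinearOrder ι] [MeasurableSpace α]
    (μ : Measure α) (G : ι → Set α) (s : Finset ι) :
    ∑ i ∈ s, ∑ j ∈ s, μ.real (G i ∩ G j) ≤
      2 * ∑ i ∈ s, ∑ j ∈ s, if i ≤ j then μ.real (G i ∩ G j) else 0 := by
  have h : ∑ i ∈ s, ∑ j ∈ s, (if j ≤ i then μ.real (G i ∩ G j) else 0) =
      ∑ i ∈ s, ∑ j ∈ s, if i ≤ j then μ.real (G i ∩ G j) else 0 := by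
    rw [Finset.sum_comm]
    simp_rw [Set.inter_comm]
  rw [two_mul]
  nth_rewrite 1 [← h]
  simp_rw [← Finset.sum_add_distrib]
  refine Finset.sum_le_sum fun i _ => Finset.sum_le_sum fun j _ => ?_
  have := measureReal_nonneg (μ := μ) (s := G i ∩ G j)
  rcases le_total i j with hij | hij <;> rw [if_pos hij] <;> split_ifs <;> linarith

/-- The divergence half of the criterion. -/
theorem not_ae_zero_mem_of_not_summable {r : ℕ+ → ℝ} (hr : ∀ n, 0 < r n) (ha : Antitone r)
    (hm : Monotone fun n : ℕ+ => (n : ℝ) * r n) (h0 : Tendsto r atTop (nhds 0))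
    (hs : ¬ Summable fun n : ℕ+ => r n * Real.exp (-2 * (n : ℝ) * r n)) :
    ¬ ∀ᵐ x ∂iidUniform, 0 ∈ uniformCoveringSet r x := by
  -- The `2` comes from restricting to ordered pairs; `13` is `1` for the diagonal plus `12` for the
  -- geometric tails, and `exp 4` is the quasi-independence constant.
  set C : ℝ := 2 * (13 + Real.exp 4) with hC
  have hCpos : 0 < C := by positivity
  refine not_ae_zero_mem_of_le (c := ENNReal.ofReal (2 * C)⁻¹) (by positivity) ?_
  have hev : ∀ᶠ N in atTop, r N < 1 / 4 := h0.eventually (gt_mem_nhds (by norm_num))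
  filter_upwards [hev] with m hm4
  obtain ⟨s, hsm, hs1⟩ := exists_finset_one_le_sum (t := Set.Ici m)
    (fun N => measureReal_nonneg (μ := iidUniform) (s := firstHit (r N) N))
    (not_summable_measureReal_firstHit hr h0 hs) (by simp [Set.finite_Iio m])
  set S := ∑ N ∈ s, iidUniform.real (firstHit (r N) N) with hS
  have hrow (M : ℕ+) (hM : M ∈ s) :
      ∑ N ∈ s, (if M ≤ N then iidUniform.real (firstHit (r M) M ∩ firstHit (r N) N) else 0) ≤
        iidUniform.real (firstHit (r M) M) * (13 + Real.exp 4 * S) := by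
    set a := iidUniform.real (firstHit (r M) M) with ha'
    have ha0 : 0 ≤ a := measureReal_nonneg
    have hM4 : 2 * r M ≤ 1 / 2 := by
      have := ha (hsm M hM)
      linarith
    calc ∑ N ∈ s, (if M ≤ N then iidUniform.real (firstHit (r M) M ∩ firstHit (r N) N) else 0)
        ≤ ∑ N ∈ s, ((if M = N then a else 0) +
            Real.exp 4 * a * iidUniform.real (firstHit (r N) N) +
            a * (if M < N then
              4 / (M : ℝ) * Real.exp (-(1 / (2 * M))) ^ ((N : ℕ) - M) else 0)) := by
          refine Finset.sum_le_sum fun N _ => ?_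
          have hN0 : 0 ≤ Real.exp 4 * a * iidUniform.real (firstHit (r N) N) := by positivity
          rcases lt_trichotomy M N with h | h | h
          · rw [if_pos h.le, if_neg h.ne, if_pos h, zero_add]
            exact measureReal_firstHit_inter_le hr ha hm h hM4
          · subst h
            simp only [le_refl, if_true, Set.inter_self, lt_irrefl, if_false, mul_zero, add_zero]
            linarith
          · rw [if_neg h.not_ge, if_neg h.ne', if_neg h.not_gt]
            linarith
      _ = a + Real.exp 4 * a * S + a * ∑ N ∈ s, (if M < N then
              4 / (M : ℝ) * Real.exp (-(1 / (2 * M))) ^ ((N : ℕ) - M) else 0) := by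
          rw [Finset.sum_add_distrib, Finset.sum_add_distrib, ← Finset.mul_sum, ← Finset.mul_sum,
            Finset.sum_ite_eq, if_pos hM]
      _ ≤ a + Real.exp 4 * a * S + a * 12 := by
          gcongr
          exact sum_geometric_tail_le s M
      _ = _ := by ring
  have hsecond : ∑ M ∈ s, ∑ N ∈ s, iidUniform.real (firstHit (r M) M ∩ firstHit (r N) N) ≤
      C * (S + S ^ 2) := by
    refine (sum_measureReal_inter_le iidUniform (fun N => firstHit (r N) N) s).trans ?_
    refine (mul_le_mul_of_nonneg_left (Finset.sum_le_sum hrow) zero_le_two).trans ?_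
    rw [← Finset.sum_mul, ← hS, hC]
    have := Real.exp_pos 4
    nlinarith
  have hfinal := half_inv_le_measureReal_biUnion (μ := iidUniform)
    (G := fun N => firstHit (r N) N) (fun N => measurableSet_firstHit (r N) N) s hCpos hs1 hsecond
  refine (ENNReal.ofReal_le_ofReal hfinal).trans ?_
  rw [ofReal_measureReal (measure_ne_top _ _)]
  refine measure_mono (Set.iUnion₂_subset fun N hN => ?_)
  exact (Set.inter_subset_left).trans (Set.subset_biUnion_of_mem
    (u := fun N => avoiding (r N) N) (hsm N hN : N ∈ {n | n ≥ m}))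

/-! ### The criterion in terms of the two series -/

theorem summable_mul_exp_neg_of_le {r : ℕ+ → ℝ} (hr : ∀ n, 0 < r n) (ha : Antitone r) {δ : ℝ}
    (hδ : 0 < δ) (h : ∀ n, δ ≤ r n) :
    Summable fun n : ℕ+ => r n * Real.exp (-2 * (n : ℝ) * r n) := by
  have hgeo : Summable fun n : ℕ+ => r 1 * Real.exp (-(2 * δ)) ^ (n : ℕ) :=
    ((summable_geometric_of_lt_one (Real.exp_pos _).le
      (Real.exp_lt_one_iff.2 (by linarith))).comp_injective PNat.coe_injective).mul_left _
  refine hgeo.of_nonneg_of_le (fun n => mul_nonneg (hr n).le (Real.exp_pos _).le) fun n => ?_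
  rw [← Real.exp_nat_mul]
  have h1 : (0 : ℝ) < (n : ℕ) := by exact_mod_cast n.pos
  refine mul_le_mul (ha one_le) (Real.exp_le_exp.2 ?_) (Real.exp_pos _).le (hr 1).le
  nlinarith [h n]

theorem summable_of_summable_mul_exp_neg {r : ℕ+ → ℝ} (hr : ∀ n, 0 < r n) {C : ℝ}
    (hC : ∀ n : ℕ+, (n : ℝ) * r n ≤ C)
    (h : Summable fun n : ℕ+ => r n * Real.exp (-2 * (n : ℝ) * r n)) : Summable r := by
  refine (h.mul_left (Real.exp (2 * C))).of_nonneg_of_le (fun n => (hr n).le) fun n => ?_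
  have h1 : 1 ≤ Real.exp (2 * C) * Real.exp (-2 * (n : ℝ) * r n) := by
    rw [← Real.exp_add]
    exact Real.one_le_exp (by linarith [hC n])
  nlinarith [hr n]

theorem not_summable_of_monotone_mul {r : ℕ+ → ℝ} (hr : ∀ n, 0 < r n)
    (hm : Monotone fun n : ℕ+ => (n : ℝ) * r n) : ¬ Summable r := by
  intro h
  have h1 : Summable fun n : ℕ+ => ((n : ℕ) : ℝ)⁻¹ := by
    refine (h.mul_left (r 1)⁻¹).of_nonneg_of_le (fun n => by positivity) fun n => ?_
    have h2 := hm (one_le : 1 ≤ n)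
    simp only [PNat.one_coe, Nat.cast_one, one_mul] at h2
    have h3 : (0 : ℝ) < (n : ℕ) := by exact_mod_cast n.pos
    rw [inv_mul_eq_div, inv_eq_one_div, div_le_div_iff₀ h3 (hr 1)]
    linarith
  exact Real.not_summable_natCast_inv (summable_pnat_iff_summable_nat.1 h1)

/-- The criterion for `0` to be almost surely uniformly covered. -/
theorem ae_zero_mem_iff {r : ℕ+ → ℝ} (hr : ∀ n, 0 < r n) (ha : Antitone r)
    (hm : Monotone (fun n : ℕ+ => (n : ℝ) * r n) ∨ Antitone (fun n : ℕ+ => (n : ℝ) * r n)) :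
    (∀ᵐ x ∂iidUniform, 0 ∈ uniformCoveringSet r x) ↔
      ¬ Summable r ∧ Summable fun n : ℕ+ => r n * Real.exp (-2 * (n : ℝ) * r n) := by
  rcases hm with hm | hm
  · have hns := not_summable_of_monotone_mul hr hm
    refine ⟨fun h => ⟨hns, ?_⟩, fun ⟨_, h⟩ => ?_⟩
    · rcases tendsto_zero_or_exists_forall_le hr ha with h0 | ⟨δ, hδ, hle⟩
      · by_contra hs
        exact not_ae_zero_mem_of_not_summable hr ha hm h0 hs h
      · exact summable_mul_exp_neg_of_le hr ha hδ hle
    · refine ae_zero_mem_of_summable hr ha h ?_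
      -- If `n * r n` had a finite limit, the exponential factor would be bounded below and `r`
      -- itself would be summable.
      rcases tendsto_atTop_of_monotone hm with ht | ⟨l, hl⟩
      · exact ht
      · exact absurd (summable_of_summable_mul_exp_neg hr (hm.ge_of_tendsto hl) h) hns
  · have hC (n : ℕ+) : (n : ℝ) * r n ≤ r 1 := by simpa using hm one_le
    refine ⟨fun h => absurd h (not_ae_zero_mem_of_mul_le hr hC), fun ⟨h1, h2⟩ => ?_⟩
    exact absurd (summable_of_summable_mul_exp_neg hr hC h2) h1

/-! ### The iterated-logarithm example -/

theorem uniformCoveringSet_congr {r r' : ℕ+ → ℝ} (h : r =ᶠ[atTop] r') (x : ℕ+ → UnitAddCircle) :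
    uniformCoveringSet r x = uniformCoveringSet r' x := by
  ext y
  exact eventually_congr (h.mono fun N hN => by rw [hN])

theorem uniformCoveringSet_eq_empty {r : ℕ+ → ℝ} (h : ∀ᶠ N in atTop, r N ≤ 0)
    (x : ℕ+ → UnitAddCircle) : uniformCoveringSet r x = ∅ := by
  refine Set.eq_empty_of_forall_notMem fun y (hy : ∀ᶠ N in atTop, ∃ n ≤ N, ‖x n - y‖ < r N) => ?_
  obtain ⟨N, hN, n, -, hn⟩ := (h.and hy).exists
  exact absurd (norm_nonneg (x n - y)) (not_le.2 (hn.trans_le hN))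

theorem one_le_log_log {x : ℝ} (hx : Real.exp (Real.exp 1) ≤ x) :
    1 ≤ Real.log (Real.log x) := by
  have h1 : Real.exp 1 ≤ Real.log x :=
    (Real.le_log_iff_exp_le ((Real.exp_pos _).trans_le hx)).2 hx
  exact (Real.le_log_iff_exp_le ((Real.exp_pos _).trans_le h1)).2 h1

theorem log_log_le_log_log {x y : ℝ} (hx : Real.exp (Real.exp 1) ≤ x) (hxy : x ≤ y) :
    Real.log (Real.log x) ≤ Real.log (Real.log y) := by
  have hx0 : 0 < x := (Real.exp_pos _).trans_le hx
  have h1 : Real.exp 1 ≤ Real.log x := (Real.le_log_iff_exp_le hx0).2 hx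
  exact Real.log_le_log ((Real.exp_pos _).trans_le h1) (Real.log_le_log hx0 hxy)

/-- The quotient is `log (log x) / log x` times `log x / x`, and `log t / t` decreases for `t ≥ e`;
the threshold `exp (exp 1)` puts both `x` and `log x` in that range. -/
theorem log_log_div_le {x y : ℝ} (hx : Real.exp (Real.exp 1) ≤ x) (hxy : x ≤ y) :
    Real.log (Real.log y) / y ≤ Real.log (Real.log x) / x := by
  have hx0 : 0 < x := (Real.exp_pos _).trans_le hx
  have hex : Real.exp 1 ≤ x := by
    refine le_trans (Real.exp_le_exp.2 ?_) hx
    exact Real.one_le_exp zero_le_one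
  have h1 : Real.exp 1 ≤ Real.log x := (Real.le_log_iff_exp_le hx0).2 hx
  have hlog : Real.log x ≤ Real.log y := Real.log_le_log hx0 hxy
  have hlx : 0 < Real.log x := (Real.exp_pos _).trans_le h1
  have hly : 0 < Real.log y := hlx.trans_le hlog
  have e (z : ℝ) (hz : 0 < Real.log z) : Real.log (Real.log z) / z =
      Real.log (Real.log z) / Real.log z * (Real.log z / z) := by
    field_simp
  rw [e x hlx, e y hly]
  refine mul_le_mul (Real.log_div_self_antitoneOn h1 (h1.trans hlog) hlog)
    (Real.log_div_self_antitoneOn hex (hex.trans hxy) hxy)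
    (div_nonneg hly.le (hx0.trans_le hxy).le) (div_nonneg ?_ hlx.le)
  linarith [one_le_log_log hx]

theorem summable_log_mul_rpow_neg_iff {a c : ℝ} (ha : 0 < a) :
    Summable (fun k : ℕ => Real.log (k * a) * (k * a) ^ (-c)) ↔ 1 < c := by
  have hlarge : ∀ b : ℝ, ∀ᶠ k : ℕ in atTop, b ≤ k * a := fun b =>
    (tendsto_natCast_atTop_atTop.atTop_mul_const ha).eventually_ge_atTop b
  constructor
  · intro h
    have h1 : Summable fun k : ℕ => ((k : ℝ) * a) ^ (-c) := by
      refine Summable.of_norm_bounded_eventually_nat h ?_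
      filter_upwards [hlarge (Real.exp 1)] with k hk
      have hk0 : 0 < (k : ℝ) * a := (Real.exp_pos 1).trans_le hk
      rw [Real.norm_of_nonneg (by positivity)]
      exact le_mul_of_one_le_left (by positivity) ((Real.le_log_iff_exp_le hk0).2 hk)
    have h2 : Summable fun k : ℕ => (k : ℝ) ^ (-c) := by
      refine (h1.mul_right (a ^ (-c))⁻¹).congr fun k => ?_
      rw [Real.mul_rpow (by positivity) ha.le, mul_inv_cancel_right₀]
      positivity
    linarith [Real.summable_nat_rpow.1 h2]
  · intro hc
    -- Half of the margin `c - 1` absorbs the logarithm and still leaves an exponent below `-1`.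
    set ε := (c - 1) / 2 with hε
    have hε0 : 0 < ε := by rw [hε]; linarith
    have h1 : Summable fun k : ℕ => (k : ℝ) ^ (ε + -c) * (a ^ (ε + -c) / ε) :=
      (Real.summable_nat_rpow.2 (by rw [hε]; linarith)).mul_right _
    refine Summable.of_norm_bounded_eventually_nat h1 ?_
    filter_upwards [hlarge 1] with k hk
    have hk0 : 0 < (k : ℝ) * a := by linarith
    rw [Real.norm_of_nonneg (mul_nonneg (Real.log_nonneg hk) (by positivity))]
    calc Real.log (k * a) * (k * a) ^ (-c)
        ≤ (k * a) ^ ε / ε * (k * a) ^ (-c) := by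
          gcongr
          exact Real.log_le_rpow_div hk0.le hε0
      _ = (k * a) ^ (ε + -c) / ε := by rw [Real.rpow_add hk0]; ring
      _ = _ := by rw [Real.mul_rpow (by positivity) ha.le]; ring

section LogLog

variable {c : ℝ} {n₀ : ℕ}

/-- The radii `c log log n / (2 n)`, made constant for `n ≤ n₀`. -/
noncomputable def logLogRadius (c : ℝ) (n₀ n : ℕ) : ℝ :=
  c / 2 * (Real.log (Real.log (max n n₀ : ℕ)) / (max n n₀ : ℕ))

theorem exp_exp_one_le_max (h₀ : Real.exp (Real.exp 1) ≤ n₀) (n : ℕ) :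
    Real.exp (Real.exp 1) ≤ (max n n₀ : ℕ) :=
  h₀.trans (by exact_mod_cast le_max_right n n₀)

theorem logLogRadius_pos (hc : 0 < c) (h₀ : Real.exp (Real.exp 1) ≤ n₀) (n : ℕ) :
    0 < logLogRadius c n₀ n := by
  have h := exp_exp_one_le_max h₀ n
  have h1 := one_le_log_log h
  have h2 := (Real.exp_pos _).trans_le h
  exact mul_pos (by linarith) (div_pos (by linarith) h2)

theorem antitone_logLogRadius (hc : 0 < c) (h₀ : Real.exp (Real.exp 1) ≤ n₀) :
    Antitone (logLogRadius c n₀) := fun m n hmn => by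
  refine mul_le_mul_of_nonneg_left (log_log_div_le (exp_exp_one_le_max h₀ m) ?_) (by linarith)
  exact_mod_cast max_le_max_right n₀ hmn

theorem max_mul_logLogRadius (h₀ : Real.exp (Real.exp 1) ≤ n₀) (n : ℕ) :
    (max n n₀ : ℕ) * logLogRadius c n₀ n = c / 2 * Real.log (Real.log (max n n₀ : ℕ)) := by
  have h2 := (Real.exp_pos _).trans_le (exp_exp_one_le_max h₀ n)
  unfold logLogRadius
  field_simp

theorem monotone_mul_logLogRadius (hc : 0 < c) (h₀ : Real.exp (Real.exp 1) ≤ n₀) :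
    Monotone fun n : ℕ => (n : ℝ) * logLogRadius c n₀ n := by
  intro m n hmn
  rcases le_total n n₀ with hn | hn
  · have : logLogRadius c n₀ m = logLogRadius c n₀ n := by
      simp only [logLogRadius, max_eq_right hn, max_eq_right (hmn.trans hn)]
    simp only [this]
    have := (logLogRadius_pos hc h₀ n).le
    gcongr
  · have hn' : (max n n₀ : ℕ) = n := max_eq_left hn
    have hle : (max m n₀ : ℕ) ≤ max n n₀ := max_le_max_right n₀ hmn
    calc (m : ℝ) * logLogRadius c n₀ m ≤ (max m n₀ : ℕ) * logLogRadius c n₀ m := by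
          refine mul_le_mul_of_nonneg_right ?_ (logLogRadius_pos hc h₀ m).le
          exact_mod_cast le_max_left m n₀
      _ ≤ (max n n₀ : ℕ) * logLogRadius c n₀ n := by
          rw [max_mul_logLogRadius h₀, max_mul_logLogRadius h₀]
          refine mul_le_mul_of_nonneg_left
            (log_log_le_log_log (exp_exp_one_le_max h₀ m) ?_) (by linarith)
          exact_mod_cast hle
      _ = n * logLogRadius c n₀ n := by rw [hn']

/-- Cauchy condensation: at `n = 2 ^ k` the exponential becomes `(k log 2) ^ (-c)` and `n` times the
radius becomes `c / 2 * log (k log 2)`. -/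
theorem summable_logLogRadius_mul_exp_neg_iff (hc : 0 < c) (h₀ : Real.exp (Real.exp 1) ≤ n₀) :
    Summable (fun n : ℕ => logLogRadius c n₀ n * Real.exp (-2 * n * logLogRadius c n₀ n)) ↔
      1 < c := by
  rw [← summable_condensed_iff_of_nonneg
    (fun n => mul_nonneg (logLogRadius_pos hc h₀ n).le (Real.exp_pos _).le)
    (fun m n _ hmn => ?_), ← summable_log_mul_rpow_neg_iff (Real.log_pos one_lt_two),
    ← summable_mul_left_iff (f := fun k : ℕ => Real.log (k * Real.log 2) * _) (a := c / 2)
      (by positivity)]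
  · refine summable_congr_atTop ?_
    filter_upwards [eventually_ge_atTop n₀] with k hk
    have hk2 : n₀ ≤ 2 ^ k := hk.trans Nat.lt_two_pow_self.le
    have hmax : (max (2 ^ k) n₀ : ℕ) = 2 ^ k := max_eq_left hk2
    have hlog : Real.log ((2 : ℝ) ^ k) = k * Real.log 2 := by rw [Real.log_pow]
    have hpos : 0 < k * Real.log 2 := by
      have h := exp_exp_one_le_max h₀ (2 ^ k)
      have h1 := (Real.le_log_iff_exp_le ((Real.exp_pos _).trans_le h)).2 h
      rw [hmax, Nat.cast_pow, Nat.cast_ofNat, hlog] at h1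
      exact (Real.exp_pos _).trans_le h1
    have hmul := max_mul_logLogRadius (c := c) h₀ (2 ^ k)
    rw [hmax] at hmul
    push_cast at hmul ⊢
    rw [hlog] at hmul
    rw [← mul_assoc, hmul, mul_assoc (-2 : ℝ), hmul, Real.rpow_def_of_pos hpos, mul_assoc]
    congr 3
    ring
  · refine mul_le_mul (antitone_logLogRadius hc h₀ hmn) (Real.exp_le_exp.2 ?_)
      (Real.exp_pos _).le (logLogRadius_pos hc h₀ m).le
    have := monotone_mul_logLogRadius hc h₀ hmn
    simp only at this
    linarith

end LogLog

theorem ae_zero_mem_logLog_iff {c : ℝ} (hc : 0 < c) {r : ℕ+ → ℝ}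
    (hr : ∀ᶠ n : ℕ+ in atTop, r n = c * Real.log (Real.log (n : ℝ)) / (2 * (n : ℝ))) :
    (∀ᵐ x ∂iidUniform, 0 ∈ uniformCoveringSet r x) ↔ 1 < c := by
  obtain ⟨n₀, h₀⟩ := exists_nat_ge (Real.exp (Real.exp 1))
  have hn₀ : 0 < n₀ := by exact_mod_cast (Real.exp_pos _).trans_le h₀
  have heq : r =ᶠ[atTop] fun n : ℕ+ => logLogRadius c n₀ n := by
    filter_upwards [hr, eventually_ge_atTop (⟨n₀, hn₀⟩ : ℕ+)] with n hn hn'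
    have hmax : (max n n₀ : ℕ) = n := max_eq_left hn'
    rw [hn, logLogRadius, hmax]
    ring
  simp_rw [uniformCoveringSet_congr heq]
  have hm : Monotone fun n : ℕ+ => ((n : ℕ) : ℝ) * logLogRadius c n₀ n :=
    fun m n hmn => monotone_mul_logLogRadius hc h₀ (show (m : ℕ) ≤ n from hmn)
  have hp (n : ℕ+) := logLogRadius_pos hc h₀ n
  rw [ae_zero_mem_iff hp (fun m n hmn => antitone_logLogRadius hc h₀ (show (m : ℕ) ≤ n from hmn))
    (.inl hm), and_iff_right (not_summable_of_monotone_mul hp hm),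
    ← summable_logLogRadius_mul_exp_neg_iff hc h₀, ← summable_pnat_iff_summable_nat]

theorem theorem2p2 :
    -- zero-one law; which alternative holds depends on `r` only
    (∀ r : ℕ+ → ℝ, (∀ n, 0 < r n) → Antitone r →
      (∀ (Ω : Type u) [MeasurableSpace Ω] (P : Measure Ω) [IsProbabilityMeasure P]
          (ω : ℕ+ → Ω → UnitAddCircle), IsIIDUniform P ω →
          ∀ᵐ a ∂P, volume (uniformCoveringSet r (fun n => ω n a)) = 1) ∨
      (∀ (Ω : Type u) [MeasurableSpace Ω] (P : Measure Ω) [IsProbabilityMeasure P]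
          (ω : ℕ+ → Ω → UnitAddCircle), IsIIDUniform P ω →
          ∀ᵐ a ∂P, volume (uniformCoveringSet r (fun n => ω n a)) = 0)) ∧
    -- criterion for full measure
    (∀ r : ℕ+ → ℝ, (∀ n, 0 < r n) → Antitone r →
      (Monotone (fun n : ℕ+ => (n : ℝ) * r n) ∨ Antitone (fun n : ℕ+ => (n : ℝ) * r n)) →
      ∀ (Ω : Type u) [MeasurableSpace Ω] (P : Measure Ω) [IsProbabilityMeasure P]
        (ω : ℕ+ → Ω → UnitAddCircle), IsIIDUniform P ω →
        ((∀ᵐ a ∂P, volume (uniformCoveringSet r (fun n => ω n a)) = 1) ↔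
          ¬ Summable r ∧ Summable (fun n : ℕ+ => r n * Real.exp (-2 * (n : ℝ) * r n)))) ∧
    -- the special case `r n = c log log n / (2 n)` (for large `n`, where this is meaningful)
    (∀ (c : ℝ) (r : ℕ+ → ℝ),
      (∀ᶠ n : ℕ+ in atTop, r n = c * Real.log (Real.log (n : ℝ)) / (2 * (n : ℝ))) →
      ∀ (Ω : Type u) [MeasurableSpace Ω] (P : Measure Ω) [IsProbabilityMeasure P]
        (ω : ℕ+ → Ω → UnitAddCircle), IsIIDUniform P ω →
        ((∀ᵐ a ∂P, volume (uniformCoveringSet r (fun n => ω n a)) = 1) ↔ 1 < c)) := by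
  refine ⟨fun r hr ha => ?_, fun r hr ha hm Ω _ P _ ω h => ?_, fun c r hr Ω _ P _ ω h => ?_⟩
  · refine (ae_zero_mem_or_ae_zero_notMem hr ha).imp ?_ ?_
    · intro h0 Ω _ P _ ω h
      rwa [h.ae_volume_uniformCoveringSet_iff, ae_volume_uniformCoveringSet_eq_one_iff]
    · intro h0 Ω _ P _ ω h
      rwa [h.ae_volume_uniformCoveringSet_iff, ae_volume_uniformCoveringSet_eq_zero_iff]
  · rw [h.ae_volume_uniformCoveringSet_iff, ae_volume_uniformCoveringSet_eq_one_iff,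
      ae_zero_mem_iff hr ha hm]
  · rcases lt_or_ge 0 c with hc | hc
    · rw [h.ae_volume_uniformCoveringSet_iff, ae_volume_uniformCoveringSet_eq_one_iff,
        ae_zero_mem_logLog_iff hc hr]
    -- For `c ≤ 0` the radii are eventually nonpositive, so the covering set is empty.
    · refine ⟨fun hae => ?_, fun h1 => absurd h1 (by linarith)⟩
      obtain ⟨n₀, h₀⟩ := exists_nat_ge (Real.exp (Real.exp 1))
      have hn₀ : 0 < n₀ := by exact_mod_cast (Real.exp_pos _).trans_le h₀
      have hle : ∀ᶠ n : ℕ+ in atTop, r n ≤ 0 := by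
        filter_upwards [hr, eventually_ge_atTop (⟨n₀, hn₀⟩ : ℕ+)] with n hn hn'
        have h2 : Real.exp (Real.exp 1) ≤ (n : ℕ) :=
          h₀.trans (by exact_mod_cast (show n₀ ≤ (n : ℕ) from hn'))
        have h3 := one_le_log_log h2
        rw [hn]
        exact div_nonpos_of_nonpos_of_nonneg
          (mul_nonpos_of_nonpos_of_nonneg hc (by linarith)) (by positivity)
      obtain ⟨a, ha⟩ := hae.exists
      rw [uniformCoveringSet_eq_empty hle, measure_empty] at ha
      exact absurd ha zero_ne_one
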